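/- Let $\mathbb D=\{z\in\mathbb C:|z|<1\}$, and let $\mathcal S$ be the class of analytic univalent functions $f(z)=z+\sum_{n\ge 2}a_nz^n$ on $\mathbb D$. For $\phi$ analytic on $\mathbb D$ with $\phi(0)=1$, let $\mathcal S^*(\phi)$ be the class of all $f\in\mathcal S$ with $zf'(z)/f(z)\prec\phi(z)$, that is, $zf'(z)/f(z)=\phi(\omega(z))$ on $\mathbb D$ (with value $1$ at $z=0$) for some analytic $\omega:\mathbb D\to\mathbb D$ with $\omega(0)=0$. Let $0\le\alpha<0.05284$, $\phi_\alpha(z)=\alpha+(1-\alpha)e^z$, and $\mathcal S^*_{\alpha,e}=\mathcal S^*(\phi_\alpha)$. Then there is a function $h\in\mathcal S$ with $zh'(z)/h(z)=\phi_\alpha(z)$ on $\mathbb D$, and for any such $h$ the following hold. The limit $h(-1):=\lim_{r\to1^-}h(-r)$ exists, the equation $$h(r)+h(-1)=0$$ has a smallest root $r_f$ in $(0,1)$, and $0<r_f<1/3$. Every $f\in\mathcal S^*_{\alpha,e}$ satisfies $$|z|+\sum_{n=2}^\infty|a_n||z|^n\le d\bigl(f(0),\partial f(\mathbb D)\bigr)\qquad\text{for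 } |z|\le r_f,$$ where $d$ is the Euclidean distance. The radius is the best possible: $r_f$ is the largest number $\rho\in(0,1)$ such that this inequality holds for all $f\in\mathcal S^*_{\alpha,e}$ and all $|z|\le\rho$. In particular, for $\alpha=0$ the number $r_f$ is the sharp Bohr radius of $\mathcal S^*_e=\mathcal S^*(e^z)$. -/

import Mathlib

open Set Filter Topology Metric

noncomputable section

namespace BohrStarlike

/-- The open unit disk. -/
def disk : Set ℂ := ball (0 : ℂ) 1

/-- The class of normalized univalent functions: `f` is analytic and injective on the unit disk,
`f 0 = 0` and `f' 0 = 1`. Values outside the disk are irrelevant. -/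
def Univalent : Set (ℂ → ℂ) :=
  {f | DifferentiableOn ℂ f disk ∧ InjOn f disk ∧ f 0 = 0 ∧ deriv f 0 = 1}

/-- Subordination `g ≺ φ` in the unit disk: `g = φ ∘ ω` for an analytic self-map `ω` of the disk
that fixes the origin. -/
def Subordinate (g φ : ℂ → ℂ) : Prop :=
  ∃ ω : ℂ → ℂ, DifferentiableOn ℂ ω disk ∧ MapsTo ω disk disk ∧ ω 0 = 0 ∧
    ∀ z ∈ disk, g z = φ (ω z)

/-- The function `z f'(z) / f(z)`, with its removable singularity at the origin filled in: for `f`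
with `f 0 = 0` and `f' 0 = 1` the limit at `0` is `1`. -/
def starQuotient (f : ℂ → ℂ) (z : ℂ) : ℂ :=
  if z = 0 then 1 else z * deriv f z / f z

/-- The Ma-Minda type starlike class of `φ`. -/
def maMindaStarlike (φ : ℂ → ℂ) : Set (ℂ → ℂ) :=
  {f | f ∈ Univalent ∧ Subordinate (starQuotient f) φ}

/-- `h` is the Koebe-type function of the Ma-Minda class of `φ`: a normalized univalent function
with `z h'(z) / h(z) = φ z` on the disk. -/
def IsKoebeFunction (φ h : ℂ → ℂ) : Prop :=
  h ∈ Univalent ∧ ∀ z ∈ disk, starQuotient h z = φ z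

/-- The function `α + (1 - α) e ^ z`. -/
def expFun (α : ℝ) (z : ℂ) : ℂ := (α : ℂ) + (1 - (α : ℂ)) * Complex.exp z

/-- The `n`-th Taylor coefficient of `f` at the origin. -/
def taylorCoeff (f : ℂ → ℂ) (n : ℕ) : ℂ := iteratedDeriv n f 0 / (n.factorial : ℂ)

/-- The Bohr inequality `|z| + ∑_{n ≥ 2} |a_n| |z| ^ n ≤ d (f 0, ∂ f(𝔻))` at the point `z`, with
both sides in `[0, ∞]`, so that no convergence or non-emptiness convention enters. -/
def BohrInequality (f : ℂ → ℂ) (z : ℂ) : Prop :=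
  ‖z‖ₑ + ∑' n : ℕ, ‖taylorCoeff f (n + 2)‖ₑ * ‖z‖ₑ ^ (n + 2)
    ≤ infEDist (f 0) (frontier (f '' disk))

/-- `R` is the (sharp) Bohr radius of the class `F` of normalized functions: the largest number in
`(0, 1)` such that every `f ∈ F` satisfies the Bohr inequality for `|z| ≤ R`. -/
def IsBohrRadius (F : Set (ℂ → ℂ)) (R : ℝ) : Prop :=
  IsGreatest {ρ : ℝ | ρ ∈ Ioo (0 : ℝ) 1 ∧ ∀ f ∈ F, ∀ z : ℂ, ‖z‖ ≤ ρ → BohrInequality f z} R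

end BohrStarlike

end

/-
Everything rests on comparing majorant series `∑ |a_n| r ^ n`. By Bohr's theorem a self-map `ω` of
the disk fixing the origin has majorant at most `r` as long as `r ≤ 1/3`, so on that range the
majorant of `φ ∘ ω` is at most that of `φ`. Dividing by `z` and integrating transfers this to
`log (f z / z)`, and exponentiating gives that the majorant of `f ∈ S*(φ)` is at most `h r`, because
the Taylor coefficients of `φ` are nonnegative. Conversely `Re φ` is smallest on `|z| ≤ r` at `-r`;
with the Schwarz lemma and integration along rays this yields `|f z| ≥ |h (-|z|)|`, so the boundary
of `f 𝔻` stays at distance at least `|h (-1)|` from the origin. Both estimates are equalities for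
`f = h`, and the root of `h r + h (-1) = 0` is therefore sharp; it lies below `1/3` since
`∫_{-1}^{1/3} (e ^ t - 1) / t dt` exceeds `log 3 / (1 - α)`.
-/

noncomputable section

namespace BohrStarlike

open scoped ComplexOrder

lemma isOpen_disk : IsOpen disk := isOpen_ball

lemma mem_disk {z : ℂ} : z ∈ disk ↔ ‖z‖ < 1 := by simp [disk]

lemma zero_mem_disk : (0 : ℂ) ∈ disk := by simp [disk]

lemma disk_mem_nhds_zero : disk ∈ 𝓝 (0 : ℂ) := isOpen_disk.mem_nhds zero_mem_disk

lemma analyticAt_zero {f : ℂ → ℂ} (hf : DifferentiableOn ℂ f disk) : AnalyticAt ℂ f 0 :=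
  hf.analyticAt disk_mem_nhds_zero

lemma differentiableOn_dslope_disk {f : ℂ → ℂ} (hf : DifferentiableOn ℂ f disk) :
    DifferentiableOn ℂ (dslope f 0) disk :=
  (Complex.differentiableOn_dslope disk_mem_nhds_zero).mpr hf

section TaylorCoeff

variable {f g : ℂ → ℂ}

lemma mul_dslope_zero (f : ℂ → ℂ) (z : ℂ) : z * dslope f 0 z = f z - f 0 := by
  simpa using sub_smul_dslope f 0 z

lemma taylorCoeff_zero (f : ℂ → ℂ) : taylorCoeff f 0 = f 0 := by simp [taylorCoeff]

lemma taylorCoeff_congr (h : f =ᶠ[𝓝 0] g) (n : ℕ) : taylorCoeff f n = taylorCoeff g n := by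
  rw [taylorCoeff, taylorCoeff, h.iteratedDeriv_eq n]

lemma taylorCoeff_eq_coeff {p : FormalMultilinearSeries ℂ ℂ ℂ} (hp : HasFPowerSeriesAt f p 0)
    (n : ℕ) : taylorCoeff f n = p.coeff n := by
  rw [hp.eq_formalMultilinearSeries hp.analyticAt.hasFPowerSeriesAt,
    FormalMultilinearSeries.coeff_ofScalars]
  rfl

lemma taylorCoeff_dslope (hf : AnalyticAt ℂ f 0) (n : ℕ) :
    taylorCoeff (dslope f 0) n = taylorCoeff f (n + 1) := by
  obtain ⟨p, hp⟩ := hf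
  rw [taylorCoeff_eq_coeff hp, taylorCoeff_eq_coeff hp.has_fpower_series_dslope_fslope,
    FormalMultilinearSeries.coeff_fslope]

lemma analyticAt_dslope_zero (hf : AnalyticAt ℂ f 0) : AnalyticAt ℂ (dslope f 0) 0 :=
  let ⟨_, hp⟩ := hf
  hp.has_fpower_series_dslope_fslope.analyticAt

lemma taylorCoeff_deriv (f : ℂ → ℂ) (n : ℕ) :
    taylorCoeff (deriv f) n = (n + 1) * taylorCoeff f (n + 1) := by
  have h : (n.factorial : ℂ) ≠ 0 := by exact_mod_cast n.factorial_ne_zero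
  have h' : (n + 1 : ℂ) ≠ 0 := by exact_mod_cast n.succ_ne_zero
  rw [taylorCoeff, taylorCoeff, iteratedDeriv_succ', Nat.factorial_succ]
  push_cast
  field_simp

lemma taylorCoeff_mul (hf : AnalyticAt ℂ f 0) (hg : AnalyticAt ℂ g 0) (n : ℕ) :
    taylorCoeff (fun z => f z * g z) n =
      ∑ p ∈ Finset.HasAntidiagonal.antidiagonal n, taylorCoeff f p.1 * taylorCoeff g p.2 := by
  rw [Finset.Nat.sum_antidiagonal_eq_sum_range_succ
    (fun i j => taylorCoeff f i * taylorCoeff g j), taylorCoeff,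
    iteratedDeriv_fun_mul hf.contDiffAt hg.contDiffAt, Finset.sum_div]
  refine Finset.sum_congr rfl fun i hi => ?_
  have hi' : i ≤ n := Nat.lt_succ_iff.mp (Finset.mem_range.mp hi)
  have h (k : ℕ) : (k.factorial : ℂ) ≠ 0 := by exact_mod_cast k.factorial_ne_zero
  have h₁ := h n
  have h₂ := h i
  have h₃ := h (n - i)
  rw [taylorCoeff, taylorCoeff, Nat.cast_choose ℂ hi']
  field_simp

lemma hasSum_taylorCoeff {R : ℝ} (hf : DifferentiableOn ℂ f (ball 0 R)) {z : ℂ}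
    (hz : z ∈ ball 0 R) : HasSum (fun n => taylorCoeff f n * z ^ n) (f z) := by
  refine (Complex.hasSum_taylorSeries_on_ball hf hz).congr_fun fun n => ?_
  simp only [taylorCoeff, sub_zero, smul_eq_mul]
  ring

end TaylorCoeff

section Majorant

variable {f g φ w : ℂ → ℂ}

/-- The majorant series `∑ |a_n| r ^ n` of the Taylor series `∑ a_n z ^ n` of `f` at the origin,
with values in `[0, ∞]`. -/
def majorant (f : ℂ → ℂ) (r : ENNReal) : ENNReal := ∑' n, ‖taylorCoeff f n‖ₑ * r ^ n

/-- The sum of the first `N` terms of the majorant series of `f`. -/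
def partialMajorant (f : ℂ → ℂ) (N : ℕ) (r : ENNReal) : ENNReal :=
  ∑ n ∈ Finset.range N, ‖taylorCoeff f n‖ₑ * r ^ n

lemma partialMajorant_le_majorant (f : ℂ → ℂ) (N : ℕ) (r : ENNReal) :
    partialMajorant f N r ≤ majorant f r :=
  ENNReal.sum_le_tsum _

lemma majorant_le_of_partialMajorant_le {r x : ENNReal} (h : ∀ N, partialMajorant f N r ≤ x) :
    majorant f r ≤ x :=
  ENNReal.tsum_le_of_sum_range_le h

lemma majorant_congr (h : f =ᶠ[𝓝 0] g) (r : ENNReal) : majorant f r = majorant g r := by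
  simp only [majorant, taylorCoeff_congr h]

lemma majorant_mono (f : ℂ → ℂ) : Monotone (majorant f) := fun _ _ h =>
  ENNReal.tsum_le_tsum fun _ => by gcongr

lemma partialMajorant_succ (hf : AnalyticAt ℂ f 0) (N : ℕ) (r : ENNReal) :
    partialMajorant f (N + 1) r = ‖f 0‖ₑ + r * partialMajorant (dslope f 0) N r := by
  rw [partialMajorant, Finset.sum_range_succ', taylorCoeff_zero, pow_zero, mul_one, add_comm,
    partialMajorant, Finset.mul_sum]
  simp only [taylorCoeff_dslope hf, pow_succ', mul_left_comm]

lemma majorant_eq_add_dslope (hf : AnalyticAt ℂ f 0) (r : ENNReal) :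
    majorant f r = ‖f 0‖ₑ + r * majorant (dslope f 0) r := by
  rw [majorant, tsum_eq_zero_add' ENNReal.summable, taylorCoeff_zero, pow_zero, mul_one, majorant,
    ← ENNReal.tsum_mul_left]
  simp only [taylorCoeff_dslope hf, pow_succ', mul_left_comm]

lemma partialMajorant_mul_le (hf : AnalyticAt ℂ f 0) (hg : AnalyticAt ℂ g 0) (N : ℕ)
    (r : ENNReal) :
    partialMajorant (fun z => f z * g z) N r ≤ partialMajorant f N r * partialMajorant g N r := by
  set F : ℕ × ℕ → ENNReal := fun p =>
    (‖taylorCoeff f p.1‖ₑ * r ^ p.1) * (‖taylorCoeff g p.2‖ₑ * r ^ p.2)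
  have h_coeff (n : ℕ) : ‖taylorCoeff (fun z => f z * g z) n‖ₑ * r ^ n ≤
      ∑ p ∈ Finset.HasAntidiagonal.antidiagonal n, F p := by
    rw [taylorCoeff_mul hf hg]
    refine (mul_le_mul_left (enorm_sum_le _ _) _).trans_eq ?_
    rw [Finset.sum_mul]
    refine Finset.sum_congr rfl fun p hp => ?_
    rw [enorm_mul, ← Finset.HasAntidiagonal.mem_antidiagonal.mp hp, pow_add]
    ring
  calc partialMajorant (fun z => f z * g z) N r
      ≤ ∑ n ∈ Finset.range N, ∑ p ∈ Finset.HasAntidiagonal.antidiagonal n, F p :=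
        Finset.sum_le_sum fun n _ => h_coeff n
    _ = ∑ p ∈ (Finset.range N).biUnion Finset.HasAntidiagonal.antidiagonal, F p :=
        (Finset.sum_biUnion fun m _ n _ hmn =>
          Finset.disjoint_left.mpr fun _ hm hn => hmn <|
            (Finset.HasAntidiagonal.mem_antidiagonal.mp hm).symm.trans
              (Finset.HasAntidiagonal.mem_antidiagonal.mp hn)).symm
    _ ≤ ∑ p ∈ Finset.range N ×ˢ Finset.range N, F p := by
        refine Finset.sum_le_sum_of_subset fun p hp => ?_
        simp only [Finset.mem_biUnion, Finset.mem_range, Finset.HasAntidiagonal.mem_antidiagonal,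
          Finset.mem_product] at hp ⊢
        lia
    _ = partialMajorant f N r * partialMajorant g N r := by
        rw [Finset.sum_product, partialMajorant, partialMajorant, Finset.sum_mul_sum]

lemma dslope_comp_zero (hφ : DifferentiableAt ℂ φ 0) (hw : DifferentiableAt ℂ w 0) (hw0 : w 0 = 0) :
    dslope (φ ∘ w) 0 = fun z => dslope w 0 z * dslope φ 0 (w z) := by
  ext z
  rcases eq_or_ne z 0 with rfl | hz
  · rw [← hw0] at hφ
    rw [dslope_same, dslope_same, hw0, dslope_same, deriv_comp 0 hφ hw, hw0, mul_comm]
  · refine mul_left_cancel₀ hz ?_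
    rw [mul_dslope_zero, ← mul_assoc, mul_dslope_zero, hw0, sub_zero, mul_dslope_zero,
      Function.comp_apply, Function.comp_apply, hw0]

lemma majorant_comp_le (hφ : AnalyticAt ℂ φ 0) (hw : AnalyticAt ℂ w 0) (hw0 : w 0 = 0)
    (r : ENNReal) : majorant (φ ∘ w) r ≤ majorant φ (majorant w r) := by
  refine majorant_le_of_partialMajorant_le fun N => ?_
  induction N generalizing φ with
  | zero => simp [partialMajorant]
  | succ N ih =>
    have hφw : AnalyticAt ℂ (φ ∘ w) 0 := hφ.comp_of_eq hw hw0
    have hφ₁ := analyticAt_dslope_zero hφ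
    have hφ₁w : AnalyticAt ℂ (dslope φ 0 ∘ w) 0 := hφ₁.comp_of_eq hw hw0
    have hw_eq : majorant w r = r * majorant (dslope w 0) r := by
      rw [majorant_eq_add_dslope hw, hw0, enorm_zero, zero_add]
    calc partialMajorant (φ ∘ w) (N + 1) r
        = ‖φ 0‖ₑ + r * partialMajorant (fun z => dslope w 0 z * (dslope φ 0 ∘ w) z) N r := by
          rw [partialMajorant_succ hφw,
            dslope_comp_zero hφ.differentiableAt hw.differentiableAt hw0, Function.comp_apply, hw0]
          rfl
      _ ≤ ‖φ 0‖ₑ + r * (majorant (dslope w 0) r * majorant (dslope φ 0) (majorant w r)) := by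
          gcongr
          exact (partialMajorant_mul_le (analyticAt_dslope_zero hw) hφ₁w N r).trans
            (mul_le_mul' (partialMajorant_le_majorant _ _ _) (ih hφ₁))
      _ = majorant φ (majorant w r) := by
          rw [majorant_eq_add_dslope hφ, ← mul_assoc, ← hw_eq]

lemma enorm_le_majorant (hf : DifferentiableOn ℂ f disk) {z : ℂ} (hz : z ∈ disk) :
    ‖f z‖ₑ ≤ majorant f ‖z‖ₑ := by
  rw [← (hasSum_taylorCoeff hf hz).tsum_eq, majorant]
  refine enorm_tsum_le_tsum_enorm.trans_eq (tsum_congr fun n => ?_)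
  rw [enorm_mul, enorm_pow]

lemma nonneg_of_taylorCoeff_nonneg {R r : ℝ} (hf : DifferentiableOn ℂ f (ball 0 R))
    (hc : ∀ n, 0 ≤ taylorCoeff f n) (hr : 0 ≤ r) (hrR : r < R) : 0 ≤ f r := by
  have hrm : (r : ℂ) ∈ ball 0 R := by simpa [abs_of_nonneg hr] using hrR
  exact (hasSum_taylorCoeff hf hrm).nonneg fun n =>
    mul_nonneg (hc n) (pow_nonneg (Complex.zero_le_real.mpr hr) n)

lemma majorant_eq_enorm_of_taylorCoeff_nonneg {R r : ℝ} (hf : DifferentiableOn ℂ f (ball 0 R))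
    (hc : ∀ n, 0 ≤ taylorCoeff f n) (hr : 0 ≤ r) (hrR : r < R) :
    majorant f (ENNReal.ofReal r) = ‖f r‖ₑ := by
  have hrm : (r : ℂ) ∈ ball 0 R := by simpa [abs_of_nonneg hr] using hrR
  have hterm (n : ℕ) : 0 ≤ taylorCoeff f n * (r : ℂ) ^ n :=
    mul_nonneg (hc n) (pow_nonneg (Complex.zero_le_real.mpr hr) n)
  have hsum : HasSum (fun n => ‖taylorCoeff f n * (r : ℂ) ^ n‖) ‖f r‖ := by
    rw [← Complex.hasSum_ofReal,
      Complex.norm_of_nonneg' (nonneg_of_taylorCoeff_nonneg hf hc hr hrR)]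
    simpa only [Complex.norm_of_nonneg' (hterm _)] using hasSum_taylorCoeff hf hrm
  rw [← ofReal_norm, ← hsum.tsum_eq,
    ENNReal.ofReal_tsum_of_nonneg (fun _ => norm_nonneg _) hsum.summable, majorant]
  refine tsum_congr fun n => ?_
  rw [ofReal_norm, enorm_mul, enorm_pow, ← ofReal_norm (r : ℂ), Complex.norm_of_nonneg hr]

lemma lintegral_ofReal_pow_Ioo (n : ℕ) {r : ℝ} (hr : 0 ≤ r) :
    ∫⁻ t in Ioo 0 r, ENNReal.ofReal t ^ n = ENNReal.ofReal r ^ (n + 1) / (n + 1) := by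
  have hint : MeasureTheory.Integrable (fun t : ℝ => t ^ n)
      (MeasureTheory.volume.restrict (Ioo 0 r)) :=
    ((continuous_pow n).integrableOn_Icc (a := 0) (b := r)).mono_set Ioo_subset_Icc_self
  have hnonneg : ∀ t ∈ Ioo 0 r, 0 ≤ t ^ n := fun t ht => pow_nonneg ht.1.le n
  calc ∫⁻ t in Ioo 0 r, ENNReal.ofReal t ^ n
      = ∫⁻ t in Ioo 0 r, ENNReal.ofReal (t ^ n) :=
        MeasureTheory.setLIntegral_congr_fun measurableSet_Ioo fun t ht =>
          (ENNReal.ofReal_pow ht.1.le n).symm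
    _ = ENNReal.ofReal (∫ t in (0 : ℝ)..r, t ^ n) := by
        rw [intervalIntegral.integral_of_le hr, MeasureTheory.integral_Ioc_eq_integral_Ioo,
          MeasureTheory.ofReal_integral_eq_lintegral_ofReal hint
            ((MeasureTheory.ae_restrict_iff' measurableSet_Ioo).mpr (.of_forall hnonneg))]
    _ = ENNReal.ofReal r ^ (n + 1) / (n + 1) := by
        rw [integral_pow, zero_pow n.succ_ne_zero, sub_zero,
          ENNReal.ofReal_div_of_pos (by positivity), ENNReal.ofReal_pow hr]
        norm_cast

lemma majorant_eq_add_lintegral (f : ℂ → ℂ) {r : ℝ} (hr : 0 ≤ r) :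
    majorant f (ENNReal.ofReal r) =
      ‖f 0‖ₑ + ∫⁻ t in Ioo 0 r, majorant (deriv f) (ENNReal.ofReal t) := by
  have hterm (n : ℕ) : ∫⁻ t in Ioo 0 r, ‖taylorCoeff (deriv f) n‖ₑ * ENNReal.ofReal t ^ n =
      ‖taylorCoeff f (n + 1)‖ₑ * ENNReal.ofReal r ^ (n + 1) := by
    rw [MeasureTheory.lintegral_const_mul _ (by fun_prop), lintegral_ofReal_pow_Ioo n hr,
      taylorCoeff_deriv, enorm_mul]
    have hcast : ‖(n + 1 : ℂ)‖ₑ = n + 1 := by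
      rw [← ofReal_norm, ← Nat.cast_succ, Complex.norm_natCast, ENNReal.ofReal_natCast,
        Nat.cast_succ]
    rw [hcast, mul_comm (n + 1 : ENNReal), mul_assoc,
      ENNReal.mul_div_cancel (by simp) (by finiteness)]
  simp only [majorant]
  rw [tsum_eq_zero_add' ENNReal.summable, taylorCoeff_zero, pow_zero, mul_one,
    MeasureTheory.lintegral_tsum fun n => by fun_prop, tsum_congr hterm]

lemma majorant_le_majorant_of_deriv {r : ℝ} (hr : 0 ≤ r) (h0 : ‖f 0‖ₑ ≤ ‖g 0‖ₑ)
    (h : ∀ t ∈ Ioo 0 r, majorant (deriv f) (ENNReal.ofReal t) ≤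
      majorant (deriv g) (ENNReal.ofReal t)) :
    majorant f (ENNReal.ofReal r) ≤ majorant g (ENNReal.ofReal r) := by
  rw [majorant_eq_add_lintegral f hr, majorant_eq_add_lintegral g hr]
  exact add_le_add h0 (MeasureTheory.setLIntegral_mono' measurableSet_Ioo h)

lemma majorant_dslope_le_of_majorant_le (hf : AnalyticAt ℂ f 0) (hg : AnalyticAt ℂ g 0)
    (h0 : f 0 = g 0) {r : ENNReal} (hr : r ≠ 0) (hr' : r ≠ ⊤) (h : majorant f r ≤ majorant g r) :
    majorant (dslope f 0) r ≤ majorant (dslope g 0) r := by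
  rw [majorant_eq_add_dslope hf, majorant_eq_add_dslope hg, h0] at h
  exact (ENNReal.mul_le_mul_iff_right hr hr').mp ((ENNReal.add_le_add_iff_left enorm_ne_top).mp h)

lemma taylorCoeff_nonneg_of_deriv (h0 : 0 ≤ f 0) (h : ∀ n, 0 ≤ taylorCoeff (deriv f) n) :
    ∀ n, 0 ≤ taylorCoeff f n
  | 0 => by rwa [taylorCoeff_zero]
  | n + 1 => by
    have h_pos : (0 : ℂ) < n + 1 := by exact_mod_cast n.succ_pos
    have h_inv : 0 ≤ ((n : ℂ) + 1)⁻¹ := by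
      rw [← Complex.ofReal_natCast, ← Complex.ofReal_one, ← Complex.ofReal_add,
        ← Complex.ofReal_inv]
      exact Complex.zero_le_real.mpr (by positivity)
    rw [← inv_mul_cancel_left₀ h_pos.ne' (taylorCoeff f (n + 1)), ← taylorCoeff_deriv]
    exact mul_nonneg h_inv (h n)

end Majorant

section Bohr

open Real (circleAverage)

variable {f p w : ℂ → ℂ} {r : ℝ} {n : ℕ}

lemma circleAverage_inv_pow_mul (hf : DifferentiableOn ℂ f disk) (hr : 0 < r) (hr1 : r < 1)
    (n : ℕ) : circleAverage (fun z => (z ^ n)⁻¹ * f z) 0 r = taylorCoeff f n := by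
  have h := (hf.mono (closedBall_subset_ball hr1)).circleIntegral_one_div_sub_center_pow_smul hr n
  calc circleAverage (fun z => (z ^ n)⁻¹ * f z) 0 r
      = (2 * Real.pi * Complex.I : ℂ)⁻¹ • ∮ z in C(0, r), (1 / (z - 0) ^ (n + 1)) • f z := by
        rw [Real.circleAverage_eq_circleIntegral hr.ne']
        simp only [sub_zero, smul_eq_mul, one_div, pow_succ', mul_inv, mul_assoc]
    _ = taylorCoeff f n := by
        rw [h, taylorCoeff, smul_eq_mul, smul_eq_mul, div_mul_eq_mul_div, mul_div_assoc,
          inv_mul_cancel_left₀ Complex.two_pi_I_ne_zero]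

lemma circleAverage_pow_mul (hf : DifferentiableOn ℂ f disk) (hr : 0 < r) (hr1 : r < 1)
    (hn : n ≠ 0) : circleAverage (fun z => z ^ n * f z) 0 r = 0 := by
  have hd : DiffContOnCl ℂ (fun z => z ^ n * f z) (ball 0 |r|) := by
    refine DifferentiableOn.diffContOnCl_ball (U := disk) ?_ ?_
    · exact (differentiableOn_pow n).mul hf
    · rw [abs_of_pos hr]
      exact closedBall_subset_ball hr1
  rw [hd.circleAverage, zero_pow hn, zero_mul]

lemma continuousOn_inv_pow (n : ℕ) : ContinuousOn (fun z : ℂ => (z ^ n)⁻¹) {0}ᶜ :=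
  (continuous_pow n).continuousOn.inv₀ fun _ hz => pow_ne_zero n hz

lemma circleIntegrable_mul_of_continuousOn {k : ℂ → ℂ} (hk : ContinuousOn k {0}ᶜ)
    (hf : DifferentiableOn ℂ f disk) (hr : 0 < r) (hr1 : r < 1) :
    CircleIntegrable (fun z => k z * f z) 0 r := by
  have hsub : sphere (0 : ℂ) r ⊆ {0}ᶜ ∩ disk := fun z hz =>
    ⟨ne_of_mem_sphere hz hr.ne', sphere_subset_ball hr1 hz⟩
  exact ((hk.mono fun z hz => (hsub hz).1).mul
    (hf.continuousOn.mono fun z hz => (hsub hz).2)).circleIntegrable hr.le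

lemma circleAverage_kernel_mul (hp : DifferentiableOn ℂ p disk) (hr : 0 < r) (hr1 : r < 1)
    (hn : n ≠ 0) (c : ℂ) :
    circleAverage (fun z => (2 + (c * z ^ n + (c * z ^ n)⁻¹)) * p z) 0 r =
      2 * p 0 + c⁻¹ * taylorCoeff p n := by
  have h_int {k : ℂ → ℂ} (hk : ContinuousOn k {0}ᶜ) : CircleIntegrable (fun z => k z * p z) 0 r :=
    circleIntegrable_mul_of_continuousOn hk hp hr hr1
  have h_two := h_int (continuousOn_const (c := 2))
  have h_pow := (h_int (continuous_pow n).continuousOn).const_smul (a := c)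
  have h_inv := (h_int (continuousOn_inv_pow n)).const_smul (a := c⁻¹)
  have h_mean : circleAverage (fun z => 2 * p z) 0 r = 2 * p 0 := by
    have h_zero := circleAverage_inv_pow_mul hp hr hr1 0
    simp only [pow_zero, inv_one, one_mul, taylorCoeff_zero] at h_zero
    simp only [← smul_eq_mul, Real.circleAverage_fun_smul, h_zero]
  calc circleAverage (fun z => (2 + (c * z ^ n + (c * z ^ n)⁻¹)) * p z) 0 r
      = circleAverage ((fun z => 2 * p z) +
          (c • (fun z => z ^ n * p z) + c⁻¹ • fun z => (z ^ n)⁻¹ * p z)) 0 r := by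
        congr 1
        ext z
        simp only [Pi.add_apply, Pi.smul_apply, smul_eq_mul, mul_inv]
        ring
    _ = 2 * p 0 + c⁻¹ * taylorCoeff p n := by
        rw [Real.circleAverage_add h_two (h_pow.add h_inv), Real.circleAverage_add h_pow h_inv,
          Real.circleAverage_smul, Real.circleAverage_smul, h_mean,
          circleAverage_pow_mul hp hr hr1 hn, circleAverage_inv_pow_mul hp hr hr1, smul_zero,
          zero_add, smul_eq_mul]

lemma circleAverage_kernel_mul_re (hp : DifferentiableOn ℂ p disk) (hr : 0 < r) (hr1 : r < 1)
    (hn : n ≠ 0) {c : ℂ} (hc : ‖c‖ * r ^ n = 1) :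
    circleAverage (fun z => (2 + 2 * (c * z ^ n).re) * (p z).re) 0 r =
      (2 * p 0 + c⁻¹ * taylorCoeff p n).re := by
  have h_cont : ContinuousOn (fun z : ℂ => 2 + (c * z ^ n + (c * z ^ n)⁻¹)) {0}ᶜ := by
    simp only [mul_inv]
    exact continuousOn_const.add
      ((by fun_prop : Continuous fun z : ℂ => c * z ^ n).continuousOn.add
        ((continuousOn_inv_pow n).const_mul _))
  rw [← circleAverage_kernel_mul hp hr hr1 hn, ← Complex.reCLM_apply,
    ← Complex.reCLM.circleAverage_comp_comm
      (circleIntegrable_mul_of_continuousOn h_cont hp hr hr1)]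
  refine Real.circleAverage_congr_sphere fun z hz => ?_
  have hz_norm : ‖c * z ^ n‖ = 1 := by
    rw [norm_mul, norm_pow, mem_sphere_zero_iff_norm.mp hz, abs_of_pos hr, hc]
  have h_kernel : 2 + (c * z ^ n + (c * z ^ n)⁻¹) = ((2 + 2 * (c * z ^ n).re : ℝ) : ℂ) := by
    rw [Complex.inv_eq_conj hz_norm, Complex.add_conj]
    push_cast
    ring
  rw [Function.comp_apply, h_kernel, Complex.reCLM_apply, Complex.re_ofReal_mul]

-- Carathéodory's inequality: `c` is chosen so that averaging `Re p` against the nonnegative kernel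
-- `2 + 2 Re (c z ^ n)` isolates `2 Re p(0) - |a_n| r ^ n`.
lemma norm_taylorCoeff_le_two_mul_re (hp : DifferentiableOn ℂ p disk)
    (hre : ∀ z ∈ disk, 0 ≤ (p z).re) (hn : n ≠ 0) : ‖taylorCoeff p n‖ ≤ 2 * (p 0).re := by
  have h_circle {r : ℝ} (hr : r ∈ Ioo 0 1) : ‖taylorCoeff p n‖ * r ^ n ≤ 2 * (p 0).re := by
    obtain ⟨u, hu, hua⟩ := RCLike.exists_norm_eq_mul_self (taylorCoeff p n)
    have hrn : 0 < r ^ n := pow_pos hr.1 n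
    set c : ℂ := -(r ^ n * u)⁻¹
    have hc : ‖c‖ * r ^ n = 1 := by
      simp [c, hu, abs_of_pos hr.1, hrn.ne']
    have h_nonneg : 0 ≤ circleAverage (fun z => (2 + 2 * (c * z ^ n).re) * (p z).re) 0 r := by
      refine Real.circleAverage_nonneg_of_nonneg fun z hz => mul_nonneg ?_ (hre z ?_)
      · have hz_norm : ‖c * z ^ n‖ = 1 := by
          rw [norm_mul, norm_pow, mem_sphere_zero_iff_norm.mp hz, abs_of_pos hr.1, hc]
        linarith [(abs_le.mp ((Complex.abs_re_le_norm (c * z ^ n)).trans_eq hz_norm)).1]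
      · rw [mem_disk, mem_sphere_zero_iff_norm.mp hz, abs_of_pos hr.1]
        exact hr.2
    have h_eq : c⁻¹ * taylorCoeff p n = ((-(‖taylorCoeff p n‖ * r ^ n) : ℝ) : ℂ) := by
      push_cast
      rw [show (‖taylorCoeff p n‖ : ℂ) = u * taylorCoeff p n from hua]
      simp only [c, inv_neg, inv_inv]
      ring
    rw [circleAverage_kernel_mul_re hp hr.1 hr.2 hn hc, h_eq, Complex.add_re, Complex.ofReal_re,
      ← Complex.ofReal_ofNat, Complex.re_ofReal_mul] at h_nonneg
    linarith
  have h_lim : Tendsto (fun r : ℝ => ‖taylorCoeff p n‖ * r ^ n) (𝓝[<] 1)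
      (𝓝 ‖taylorCoeff p n‖) := by
    have h_cont : Continuous fun r : ℝ => ‖taylorCoeff p n‖ * r ^ n := by fun_prop
    simpa using (h_cont.tendsto 1).mono_left nhdsWithin_le_nhds
  exact le_of_tendsto h_lim (mem_of_superset (Ioo_mem_nhdsLT one_pos) fun r hr => h_circle hr)

lemma norm_taylorCoeff_le_of_norm_le_one (hf : DifferentiableOn ℂ f disk)
    (hb : ∀ z ∈ disk, ‖f z‖ ≤ 1) (hn : n ≠ 0) : ‖taylorCoeff f n‖ ≤ 2 * (1 - ‖f 0‖) := by
  obtain ⟨u, hu, hu0⟩ := RCLike.exists_norm_eq_mul_self (f 0)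
  have h_re : ∀ z ∈ disk, 0 ≤ (1 + -u * f z).re := fun z hz => by
    have h_norm : ‖u * f z‖ ≤ 1 := by rw [norm_mul, hu, one_mul]; exact hb z hz
    have := (Complex.re_le_norm _).trans h_norm
    simp only [neg_mul, Complex.add_re, Complex.one_re, Complex.neg_re]
    linarith
  have h_coeff : taylorCoeff (fun z => 1 + -u * f z) n = -u * taylorCoeff f n := by
    rw [taylorCoeff, iteratedDeriv_const_add hn.pos, iteratedDeriv_const_mul_field, mul_div_assoc,
      taylorCoeff]
  have h := norm_taylorCoeff_le_two_mul_re ((hf.const_mul (-u)).const_add 1) h_re hn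
  rw [h_coeff, norm_mul, norm_neg, hu, one_mul, neg_mul,
    show u * f 0 = (‖f 0‖ : ℂ) from hu0.symm, ← Complex.ofReal_neg, Complex.add_re,
    Complex.one_re, Complex.ofReal_re] at h
  exact h

-- Bohr's theorem.
theorem majorant_le_one_of_norm_le_one (hf : DifferentiableOn ℂ f disk)
    (hb : ∀ z ∈ disk, ‖f z‖ ≤ 1) {r : ENNReal} (hr : r ≤ 3⁻¹) : majorant f r ≤ 1 := by
  have h_coeff (n : ℕ) : ‖taylorCoeff (dslope f 0) n‖ₑ ≤ 2 * ENNReal.ofReal (1 - ‖f 0‖) := by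
    rw [taylorCoeff_dslope (analyticAt_zero hf), ← ofReal_norm, ← ENNReal.ofReal_ofNat,
      ← ENNReal.ofReal_mul zero_le_two]
    exact ENNReal.ofReal_le_ofReal (norm_taylorCoeff_le_of_norm_le_one hf hb n.succ_ne_zero)
  have h_geom : (3⁻¹ : ENNReal) * (1 - 3⁻¹)⁻¹ = 2⁻¹ := by
    have h_sub : (1 - 3⁻¹ : ENNReal) = 2 * 3⁻¹ := by
      refine ENNReal.sub_eq_of_eq_add (by simp) ?_
      rw [← add_one_mul, show (2 + 1 : ENNReal) = 3 by norm_num,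
        ENNReal.mul_inv_cancel (by simp) (by simp)]
    rw [h_sub, ENNReal.mul_inv (by simp) (by simp), inv_inv, mul_left_comm,
      ENNReal.inv_mul_cancel (by simp) (by simp), mul_one]
  calc majorant f r
      ≤ ‖f 0‖ₑ + 3⁻¹ * majorant (dslope f 0) 3⁻¹ := by
        rw [← majorant_eq_add_dslope (analyticAt_zero hf)]
        exact majorant_mono f hr
    _ ≤ ‖f 0‖ₑ + 3⁻¹ * ∑' n, 2 * ENNReal.ofReal (1 - ‖f 0‖) * 3⁻¹ ^ n := by
        rw [majorant]
        gcongr with n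
        exact h_coeff n
    _ = ‖f 0‖ₑ + 2 * ENNReal.ofReal (1 - ‖f 0‖) * (3⁻¹ * (1 - 3⁻¹)⁻¹) := by
        rw [ENNReal.tsum_mul_left, ENNReal.tsum_geometric, mul_left_comm]
    _ = ENNReal.ofReal (‖f 0‖ + (1 - ‖f 0‖)) := by
        rw [h_geom, mul_right_comm, ENNReal.mul_inv_cancel (by simp) (by simp), one_mul,
          ENNReal.ofReal_add (norm_nonneg _) (sub_nonneg.mpr (hb 0 zero_mem_disk)), ofReal_norm]
    _ = 1 := by rw [add_sub_cancel, ENNReal.ofReal_one]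

theorem majorant_le_self_of_mapsTo (hw : DifferentiableOn ℂ w disk) (hm : MapsTo w disk disk)
    (h0 : w 0 = 0) {r : ENNReal} (hr : r ≤ 3⁻¹) : majorant w r ≤ r := by
  have hb : ∀ z ∈ disk, ‖dslope w 0 z‖ ≤ 1 := fun z hz => by
    have hm' : MapsTo w (ball 0 1) (closedBall (w 0) 1) := by
      rw [h0]
      exact hm.mono_right ball_subset_closedBall
    simpa using Complex.norm_dslope_le_div_of_mapsTo_ball (R₂ := 1) hw hm' hz
  calc majorant w r = r * majorant (dslope w 0) r := by
        rw [majorant_eq_add_dslope (analyticAt_zero hw), h0, enorm_zero, zero_add]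
    _ ≤ r * 1 := by
        gcongr
        exact majorant_le_one_of_norm_le_one (differentiableOn_dslope_disk hw) hb hr
    _ = r := mul_one r

end Bohr

section Representation

variable {f p : ℂ → ℂ}

lemma mul_deriv_eq_starQuotient_mul (hf : f ∈ Univalent) {z : ℂ} (hz : z ∈ disk) :
    z * deriv f z = starQuotient f z * f z := by
  rcases eq_or_ne z 0 with rfl | hz0
  · rw [hf.2.2.1, zero_mul, mul_zero]
  · have hfz : f z ≠ 0 := fun h => hz0 (hf.2.1 hz zero_mem_disk (h.trans hf.2.2.1.symm))
    rw [starQuotient, if_neg hz0, div_mul_cancel₀ _ hfz]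

lemma deriv_dslope_eq_mul_dslope (hf : DifferentiableOn ℂ f disk) (hf0 : f 0 = 0)
    (hp : DifferentiableOn ℂ p disk) (hp0 : p 0 = 1)
    (hfp : ∀ z ∈ disk, z * deriv f z = p z * f z) :
    EqOn (deriv (dslope f 0)) (fun z => dslope f 0 z * dslope p 0 z) disk := by
  have hD := differentiableOn_dslope_disk hf
  have h_punctured : EqOn (deriv (dslope f 0)) (fun z => dslope f 0 z * dslope p 0 z)
      (disk ∩ {0}ᶜ) := by
    rintro z ⟨hz, hz0 : z ≠ 0⟩
    have h_f (w : ℂ) : f w = w * dslope f 0 w := by rw [mul_dslope_zero, hf0, sub_zero]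
    have h_deriv : deriv f z = dslope f 0 z + z * deriv (dslope f 0) z := by
      conv_lhs => rw [funext h_f]
      rw [deriv_fun_mul differentiableAt_fun_id
        (hD.differentiableAt (isOpen_disk.mem_nhds hz)), deriv_id'', one_mul]
    have h_p := mul_dslope_zero p z
    have h_eq := hfp z hz
    rw [h_deriv, h_f z] at h_eq
    refine mul_left_cancel₀ (mul_ne_zero hz0 hz0) ?_
    linear_combination h_eq - z * dslope f 0 z * (h_p - hp0)
  exact h_punctured.of_subset_closure (hD.deriv isOpen_disk).continuousOn
    (hD.mul (differentiableOn_dslope_disk hp)).continuousOn inter_subset_left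
    ((dense_compl_singleton 0).open_subset_closure_inter isOpen_disk)

lemma exists_dslope_eq_exp (hf : f ∈ Univalent) (hp : DifferentiableOn ℂ p disk)
    (hfp : ∀ z ∈ disk, starQuotient f z = p z) :
    ∃ g : ℂ → ℂ, g 0 = 0 ∧ (∀ z ∈ disk, HasDerivAt g (dslope p 0 z) z) ∧
      ∀ z ∈ disk, dslope f 0 z = Complex.exp (g z) := by
  have hp0 : p 0 = 1 := by rw [← hfp 0 zero_mem_disk, starQuotient, if_pos rfl]
  have h_log := deriv_dslope_eq_mul_dslope hf.1 hf.2.2.1 hp hp0 fun z hz => by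
    rw [mul_deriv_eq_starQuotient_mul hf hz, hfp z hz]
  obtain ⟨g, hg0, hg⟩ := (differentiableOn_dslope_disk hp).isExactOn_ball.with_val_at 0 0
  have h_deriv : ∀ z ∈ disk, HasDerivAt (fun z => dslope f 0 z * Complex.exp (-g z)) 0 z :=
    fun z hz => by
      have hD := ((differentiableOn_dslope_disk hf.1).differentiableAt
        (isOpen_disk.mem_nhds hz)).hasDerivAt
      refine (hD.mul (hg z hz).neg.cexp).congr_deriv ?_
      rw [h_log hz, Pi.neg_apply]
      ring
  refine ⟨g, hg0, hg, fun z hz => ?_⟩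
  have h_const : dslope f 0 z * Complex.exp (-g z) = 1 := by
    refine (isOpen_disk.is_const_of_deriv_eq_zero (convex_ball (0 : ℂ) 1).isPreconnected
      (fun w hw => (h_deriv w hw).differentiableAt.differentiableWithinAt)
      (fun w hw => (h_deriv w hw).deriv) hz zero_mem_disk).trans ?_
    simp [hg0, hf.2.2.2]
  rwa [Complex.exp_neg, ← div_eq_mul_inv, div_eq_one_iff_eq (Complex.exp_ne_zero _)] at h_const

end Representation

section Majorization

variable {f g h φ H : ℂ → ℂ}

lemma taylorCoeff_exp_nonneg (n : ℕ) : 0 ≤ taylorCoeff Complex.exp n := by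
  rw [taylorCoeff, iteratedDeriv_eq_iterate, Complex.iter_deriv_exp, Complex.exp_zero, one_div,
    ← Complex.ofReal_natCast, ← Complex.ofReal_inv]
  exact Complex.zero_le_real.mpr (by positivity)

lemma deriv_eventuallyEq {f f' : ℂ → ℂ} (hf : ∀ z ∈ disk, HasDerivAt f (f' z) z) :
    deriv f =ᶠ[𝓝 0] f' :=
  mem_of_superset disk_mem_nhds_zero fun z hz => (hf z hz).deriv

lemma differentiableOn_of_hasDerivAt {f f' : ℂ → ℂ} (hf : ∀ z ∈ disk, HasDerivAt f (f' z) z) :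
    DifferentiableOn ℂ f disk :=
  fun z hz => (hf z hz).differentiableAt.differentiableWithinAt

lemma majorant_subordinate_le (hφ : AnalyticAt ℂ φ 0) {ω : ℂ → ℂ} (hω : DifferentiableOn ℂ ω disk)
    (hm : MapsTo ω disk disk) (h0 : ω 0 = 0) {r : ENNReal} (hr : r ≤ 3⁻¹) :
    majorant (φ ∘ ω) r ≤ majorant φ r :=
  (majorant_comp_le hφ (analyticAt_zero hω) h0 r).trans
    (majorant_mono φ (majorant_le_self_of_mapsTo hω hm h0 hr))

lemma taylorCoeff_nonneg_of_deriv_eq_dslope (hφ : DifferentiableOn ℂ φ disk)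
    (hc : ∀ n, 0 ≤ taylorCoeff φ n) (hH0 : H 0 = 0)
    (hH : ∀ z ∈ disk, HasDerivAt H (dslope φ 0 z) z) (n : ℕ) : 0 ≤ taylorCoeff H n :=
  taylorCoeff_nonneg_of_deriv hH0.ge (fun n => by
    rw [taylorCoeff_congr (deriv_eventuallyEq hH), taylorCoeff_dslope (analyticAt_zero hφ)]
    exact hc _) n

lemma majorant_eq_mul_majorant_comp (hf : DifferentiableOn ℂ f disk) (hf0 : f 0 = 0)
    (hfq : ∀ z ∈ disk, dslope f 0 z = φ (g z)) (r : ENNReal) :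
    majorant f r = r * majorant (φ ∘ g) r := by
  rw [majorant_eq_add_dslope (analyticAt_zero hf), hf0, enorm_zero, zero_add,
    majorant_congr (mem_of_superset disk_mem_nhds_zero hfq)]
  rfl

lemma norm_eq_mul_exp_re {z w : ℂ} (hf0 : f 0 = 0) (hfw : dslope f 0 z = Complex.exp w) :
    ‖f z‖ = ‖z‖ * Real.exp w.re := by
  rw [← sub_zero (f z), ← hf0, ← mul_dslope_zero, hfw, norm_mul, Complex.norm_exp]

lemma norm_eq_mul_exp_norm (hh0 : h 0 = 0) (hH : DifferentiableOn ℂ H disk)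
    (hc : ∀ n, 0 ≤ taylorCoeff H n) (hhH : ∀ z ∈ disk, dslope h 0 z = Complex.exp (H z))
    {r : ℝ} (hr : r ∈ Ico (0 : ℝ) 1) : ‖h r‖ = r * Real.exp ‖H r‖ := by
  have hr_norm : ‖(r : ℂ)‖ = r := Complex.norm_of_nonneg hr.1
  have hHr : H r = ‖H r‖ :=
    (Complex.norm_of_nonneg' (nonneg_of_taylorCoeff_nonneg hH hc hr.1 hr.2)).symm
  rw [norm_eq_mul_exp_re hh0 (hhH r (mem_disk.mpr (by rw [hr_norm]; exact hr.2))), hr_norm,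
    congrArg Complex.re hHr, Complex.ofReal_re]

lemma enorm_eq_mul_majorant_exp (hh0 : h 0 = 0) (hH : DifferentiableOn ℂ H disk)
    (hc : ∀ n, 0 ≤ taylorCoeff H n) (hhH : ∀ z ∈ disk, dslope h 0 z = Complex.exp (H z))
    {r : ℝ} (hr : r ∈ Ico (0 : ℝ) 1) :
    ‖h r‖ₑ = ENNReal.ofReal r * majorant Complex.exp (majorant H (ENNReal.ofReal r)) := by
  rw [majorant_eq_enorm_of_taylorCoeff_nonneg hH hc hr.1 hr.2, ← ofReal_norm (H r),
    majorant_eq_enorm_of_taylorCoeff_nonneg Complex.differentiable_exp.differentiableOn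
      taylorCoeff_exp_nonneg (norm_nonneg _) (lt_add_one _), ← ofReal_norm (h r),
    norm_eq_mul_exp_norm hh0 hH hc hhH hr, ENNReal.ofReal_mul hr.1, ← ofReal_norm (Complex.exp _),
    Complex.norm_exp_ofReal]

theorem majorant_le_enorm_koebe (hφ : DifferentiableOn ℂ φ disk)
    (hc : ∀ n, 0 ≤ taylorCoeff φ n) (hh : IsKoebeFunction φ h) (hf : f ∈ maMindaStarlike φ)
    {r : ℝ} (hr : 0 ≤ r) (hr3 : r ≤ 1 / 3) :
    majorant f (ENNReal.ofReal r) ≤ ‖h r‖ₑ := by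
  obtain ⟨hfU, ω, hω, hm, hω0, hfω⟩ := hf
  have hp : DifferentiableOn ℂ (φ ∘ ω) disk := hφ.comp hω hm
  obtain ⟨g, hg0, hg, hfg⟩ := exists_dslope_eq_exp hfU hp hfω
  obtain ⟨H, hH0, hH, hhH⟩ := exists_dslope_eq_exp hh.1 hφ hh.2
  have h_log : majorant g (ENNReal.ofReal r) ≤ majorant H (ENNReal.ofReal r) := by
    refine majorant_le_majorant_of_deriv hr (by rw [hg0, hH0]) fun t ht => ?_
    have ht3 : ENNReal.ofReal t ≤ 3⁻¹ := by
      rw [← ENNReal.ofReal_ofNat, ← ENNReal.ofReal_inv_of_pos three_pos]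
      exact ENNReal.ofReal_le_ofReal (by linarith [ht.2])
    rw [majorant_congr (deriv_eventuallyEq hg), majorant_congr (deriv_eventuallyEq hH)]
    exact majorant_dslope_le_of_majorant_le (analyticAt_zero hp) (analyticAt_zero hφ)
      (by rw [Function.comp_apply, hω0]) (ENNReal.ofReal_pos.mpr ht.1).ne' ENNReal.ofReal_ne_top
      (majorant_subordinate_le (analyticAt_zero hφ) hω hm hω0 ht3)
  calc majorant f (ENNReal.ofReal r)
      = ENNReal.ofReal r * majorant (Complex.exp ∘ g) (ENNReal.ofReal r) :=
        majorant_eq_mul_majorant_comp hfU.1 hfU.2.2.1 hfg _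
    _ ≤ ENNReal.ofReal r * majorant Complex.exp (majorant g (ENNReal.ofReal r)) := by
        gcongr
        exact majorant_comp_le (analyticAt_zero Complex.differentiable_exp.differentiableOn)
          (analyticAt_zero (differentiableOn_of_hasDerivAt hg)) hg0 _
    _ ≤ ENNReal.ofReal r * majorant Complex.exp (majorant H (ENNReal.ofReal r)) := by
        gcongr
        exact majorant_mono _ h_log
    _ = ‖h r‖ₑ := (enorm_eq_mul_majorant_exp hh.1.2.2.1 (differentiableOn_of_hasDerivAt hH)
        (taylorCoeff_nonneg_of_deriv_eq_dslope hφ hc hH0 hH) hhH ⟨hr, by linarith⟩).symm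

theorem strictMonoOn_norm_koebe (hφ : DifferentiableOn ℂ φ disk)
    (hc : ∀ n, 0 ≤ taylorCoeff φ n) (hh : IsKoebeFunction φ h) :
    StrictMonoOn (fun r : ℝ => ‖h r‖) (Ico 0 1) := by
  obtain ⟨H, hH0, hH, hhH⟩ := exists_dslope_eq_exp hh.1 hφ hh.2
  have hHd := differentiableOn_of_hasDerivAt hH
  have hHc := taylorCoeff_nonneg_of_deriv_eq_dslope hφ hc hH0 hH
  intro r hr s hs hrs
  have h_mono : ‖H r‖ ≤ ‖H s‖ := by
    rw [← ENNReal.ofReal_le_ofReal_iff (norm_nonneg _), ofReal_norm, ofReal_norm,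
      ← majorant_eq_enorm_of_taylorCoeff_nonneg hHd hHc hr.1 hr.2,
      ← majorant_eq_enorm_of_taylorCoeff_nonneg hHd hHc hs.1 hs.2]
    exact majorant_mono H (ENNReal.ofReal_le_ofReal hrs.le)
  simp only [norm_eq_mul_exp_norm hh.1.2.2.1 hHd hHc hhH hr,
    norm_eq_mul_exp_norm hh.1.2.2.1 hHd hHc hhH hs]
  exact mul_lt_mul hrs (Real.exp_le_exp.mpr h_mono) (Real.exp_pos _) (hr.1.trans hrs.le)

end Majorization

section Growth

variable {f h φ F F' G G' : ℂ → ℂ}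

lemma hasDerivAt_re_comp_line {a b d : ℂ} {t : ℝ} (hF : HasDerivAt F d (a + t * b)) :
    HasDerivAt (fun s : ℝ => (F (a + s * b)).re) (d * b).re t := by
  have h_line := (((hasDerivAt_id' (t : ℂ)).mul_const b).const_add a)
  rw [one_mul] at h_line
  exact (hF.comp (t : ℂ) h_line).real_of_complex

lemma ofReal_mul_mem_disk {t : ℝ} (ht : t ∈ Icc (0 : ℝ) 1) {z : ℂ} (hz : z ∈ disk) :
    (t : ℂ) * z ∈ disk := by
  rw [mem_disk, norm_mul, Complex.norm_of_nonneg ht.1]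
  exact (mul_le_of_le_one_left (norm_nonneg z) ht.2).trans_lt (mem_disk.mp hz)

lemma re_sub_le_re_sub_of_radial_deriv_le (hF : ∀ z ∈ disk, HasDerivAt F (F' z) z)
    (hG : ∀ z ∈ disk, HasDerivAt G (G' z) z) {z ζ : ℂ} (hz : z ∈ disk) (hζ : ζ ∈ disk)
    (h : ∀ t ∈ Ioo (0 : ℝ) 1, (t * ζ * G' (t * ζ)).re ≤ (t * z * F' (t * z)).re) :
    (G ζ - G 0).re ≤ (F z - F 0).re := by
  have h_deriv {K K' : ℂ → ℂ} {w : ℂ} (hK : ∀ z ∈ disk, HasDerivAt K (K' z) z) (hw : w ∈ disk)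
      (t : ℝ) (ht : t ∈ Icc (0 : ℝ) 1) :
      HasDerivAt (fun s : ℝ => (K (s * w)).re) (K' (t * w) * w).re t := by
    simpa only [zero_add] using
      hasDerivAt_re_comp_line (a := 0) (by rw [zero_add]; exact hK _ (ofReal_mul_mem_disk ht hw))
  have h_diff (t : ℝ) (ht : t ∈ Icc (0 : ℝ) 1) := (h_deriv hF hz t ht).sub (h_deriv hG hζ t ht)
  have h_mono : MonotoneOn
      ((fun s : ℝ => (F (s * z)).re) - fun s : ℝ => (G (s * ζ)).re) (Icc 0 1) := by
    refine monotoneOn_of_hasDerivWithinAt_nonneg (convex_Icc _ _)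
      (fun t ht => (h_diff t ht).continuousAt.continuousWithinAt)
      (fun t ht => (h_diff t (interior_subset ht)).hasDerivWithinAt) fun t ht => ?_
    rw [interior_Icc] at ht
    have h_re (w d : ℂ) : (t * w * d).re = t * (d * w).re := by
      rw [mul_assoc, Complex.re_ofReal_mul, mul_comm w]
    have h_le := h t ht
    rw [h_re, h_re] at h_le
    exact sub_nonneg.mpr (le_of_mul_le_mul_left h_le ht.1)
  have h_ends := h_mono (left_mem_Icc.mpr zero_le_one) (right_mem_Icc.mpr zero_le_one) zero_le_one
  simp only [Pi.sub_apply, Complex.ofReal_zero, Complex.ofReal_one, zero_mul, one_mul] at h_ends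
  rw [Complex.sub_re, Complex.sub_re]
  linarith

theorem norm_koebe_neg_le_norm (hφ : DifferentiableOn ℂ φ disk)
    (hφ_min : ∀ z ∈ disk, ∀ r < (1 : ℝ), ‖z‖ ≤ r → (φ (-r)).re ≤ (φ z).re)
    (hh : IsKoebeFunction φ h) (hf : f ∈ maMindaStarlike φ) {z : ℂ} (hz : z ∈ disk) :
    ‖h (-‖z‖)‖ ≤ ‖f z‖ := by
  obtain ⟨hfU, ω, hω, hm, hω0, hfω⟩ := hf
  obtain ⟨g, hg0, hg, hfg⟩ := exists_dslope_eq_exp hfU (hφ.comp hω hm) hfω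
  obtain ⟨H, hH0, hH, hhH⟩ := exists_dslope_eq_exp hh.1 hφ hh.2
  have hz_neg : (-‖z‖ : ℂ) ∈ disk := by
    rwa [mem_disk, norm_neg, Complex.norm_of_nonneg (norm_nonneg z), ← mem_disk]
  have h_log : (H (-‖z‖)).re ≤ (g z).re := by
    suffices h_sub : (H (-‖z‖) - H 0).re ≤ (g z - g 0).re by
      rwa [hH0, hg0, sub_zero, sub_zero] at h_sub
    refine re_sub_le_re_sub_of_radial_deriv_le hg hH hz hz_neg fun t ht => ?_
    have htz := ofReal_mul_mem_disk ⟨ht.1.le, ht.2.le⟩ hz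
    have h_norm : ‖(t : ℂ) * z‖ = t * ‖z‖ := by rw [norm_mul, Complex.norm_of_nonneg ht.1.le]
    have h_schwarz : ‖ω (t * z)‖ ≤ t * ‖z‖ := h_norm ▸
      Complex.norm_le_norm_of_mapsTo_ball (R := 1) hω (hm.mono_right ball_subset_closedBall) hω0
        (mem_disk.mp htz)
    have h_min := hφ_min _ (hm htz) (t * ‖z‖) (h_norm ▸ mem_disk.mp htz) h_schwarz
    rw [mul_dslope_zero, mul_dslope_zero, Function.comp_apply, Function.comp_apply, hω0,
      Complex.sub_re, Complex.sub_re, mul_neg, ← Complex.ofReal_mul]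
    exact sub_le_sub_right h_min _
  rw [norm_eq_mul_exp_re hh.1.2.2.1 (hhH _ hz_neg), norm_eq_mul_exp_re hfU.2.2.1 (hfg z hz),
    norm_neg, Complex.norm_of_nonneg (norm_nonneg z)]
  gcongr

end Growth

section Boundary

variable {f : ℂ → ℂ}

lemma isOpen_image (hf : f ∈ Univalent) {s : Set ℂ} (hs : s ⊆ disk) (hso : IsOpen s) :
    IsOpen (f '' s) := by
  refine ((hf.1.analyticOnNhd isOpen_disk).is_constant_or_isOpen
    (convex_ball (0 : ℂ) 1).isPreconnected).resolve_left ?_ s hs hso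
  rintro ⟨c, hc⟩
  have h_half : (1 / 2 : ℂ) ∈ disk := by rw [mem_disk]; norm_num
  have h_eq := hf.2.1 h_half zero_mem_disk ((hc _ h_half).trans (hc _ zero_mem_disk).symm)
  norm_num at h_eq

lemma le_norm_of_mem_frontier_image (hf : f ∈ Univalent) {r c : ℝ} (hr : r < 1)
    (h : ∀ z ∈ disk, r < ‖z‖ → c ≤ ‖f z‖) {y : ℂ} (hy : y ∈ frontier (f '' disk)) : c ≤ ‖y‖ := by
  rw [(isOpen_image hf subset_rfl isOpen_disk).frontier_eq] at hy
  have h_sub : closedBall (0 : ℂ) r ⊆ disk := closedBall_subset_ball hr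
  have h_closed : IsClosed (f '' closedBall 0 r) :=
    ((isCompact_closedBall 0 r).image_of_continuousOn (hf.1.continuousOn.mono h_sub)).isClosed
  have hy_cl : y ∈ closure (f '' (disk \ closedBall 0 r)) := by
    have hy' := hy.1
    rw [← union_sdiff_cancel h_sub, image_union, closure_union, h_closed.closure_eq] at hy'
    exact hy'.resolve_left fun hmem => hy.2 (image_mono h_sub hmem)
  refine closure_minimal ?_ (isClosed_le continuous_const continuous_norm) hy_cl
  rintro _ ⟨z, ⟨hz, hzr⟩, rfl⟩
  rw [mem_closedBall_zero_iff, not_le] at hzr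
  exact h z hz hzr

lemma mem_frontier_image_of_tendsto (hf : f ∈ Univalent) {ι : Type*} {l : Filter ι} [l.NeBot]
    {u : ι → ℂ} (hu : ∀ᶠ i in l, u i ∈ disk) (hu1 : Tendsto (fun i => ‖u i‖) l (𝓝 1)) {m : ℂ}
    (hm : Tendsto (fun i => f (u i)) l (𝓝 m)) : m ∈ frontier (f '' disk) := by
  rw [(isOpen_image hf subset_rfl isOpen_disk).frontier_eq]
  refine ⟨mem_closure_of_tendsto hm (hu.mono fun i hi => mem_image_of_mem f hi), ?_⟩
  rintro ⟨z₀, hz₀, rfl⟩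
  obtain ⟨s, hs, hs1⟩ := exists_between (mem_disk.mp hz₀)
  have h_sub : ball (0 : ℂ) s ⊆ disk := ball_subset_ball hs1.le
  have h_nhds : f '' ball 0 s ∈ 𝓝 (f z₀) :=
    (isOpen_image hf h_sub isOpen_ball).mem_nhds (mem_image_of_mem f (mem_ball_zero_iff.mpr hs))
  obtain ⟨i, ⟨z, hz, hzi⟩, hi, hsi⟩ :=
    ((hm.eventually h_nhds).and (hu.and (hu1.eventually_const_lt hs1))).exists
  rw [hf.2.1 (h_sub hz) hi hzi, mem_ball_zero_iff] at hz
  exact hz.not_gt hsi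

lemma mem_frontier_image_of_tendsto_neg (hf : f ∈ Univalent) {m : ℂ}
    (hm : Tendsto (fun r : ℝ => f (-(r : ℂ))) (𝓝[<] 1) (𝓝 m)) : m ∈ frontier (f '' disk) := by
  have h_norm (t : ℝ) : ‖-(t : ℂ)‖ = |t| := by rw [norm_neg, Complex.norm_real, Real.norm_eq_abs]
  refine mem_frontier_image_of_tendsto hf ?_ ?_ hm
  · filter_upwards [Ioo_mem_nhdsLT (zero_lt_one' ℝ)] with t ht
    rw [mem_disk, h_norm, abs_of_pos ht.1]
    exact ht.2
  · simp only [h_norm]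
    simpa only [abs_one] using (continuous_abs.tendsto (1 : ℝ)).mono_left nhdsWithin_le_nhds

end Boundary

section BohrRadius

variable {f h φ : ℂ → ℂ} {m : ℂ} {r : ℝ}

lemma bohrInequality_iff (hf : f ∈ Univalent) (z : ℂ) :
    BohrInequality f z ↔ majorant f ‖z‖ₑ ≤ infEDist 0 (frontier (f '' disk)) := by
  have hfa := analyticAt_zero hf.1
  have hf1 : dslope f 0 0 = 1 := by rw [dslope_same, hf.2.2.2]
  have h_tail : ∑' n : ℕ, ‖taylorCoeff f (n + 2)‖ₑ * ‖z‖ₑ ^ (n + 2) =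
      ‖z‖ₑ * (‖z‖ₑ * majorant (dslope (dslope f 0) 0) ‖z‖ₑ) := by
    rw [majorant, ← ENNReal.tsum_mul_left, ← ENNReal.tsum_mul_left]
    refine tsum_congr fun n => ?_
    rw [taylorCoeff_dslope (analyticAt_dslope_zero hfa), taylorCoeff_dslope hfa]
    ring
  rw [BohrInequality, majorant_eq_add_dslope hfa,
    majorant_eq_add_dslope (analyticAt_dslope_zero hfa), hf.2.2.1, hf1, enorm_zero, zero_add,
    enorm_one, mul_add, mul_one, h_tail]

lemma IsKoebeFunction.mem_maMindaStarlike (hh : IsKoebeFunction φ h) : h ∈ maMindaStarlike φ :=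
  ⟨hh.1, id, differentiableOn_id, mapsTo_id _, rfl, hh.2⟩

theorem enorm_le_infEDist_frontier (hφ : DifferentiableOn ℂ φ disk)
    (hφ_min : ∀ z ∈ disk, ∀ r < (1 : ℝ), ‖z‖ ≤ r → (φ (-r)).re ≤ (φ z).re)
    (hh : IsKoebeFunction φ h) (hm : Tendsto (fun r : ℝ => h (-(r : ℂ))) (𝓝[<] 1) (𝓝 m))
    (hf : f ∈ maMindaStarlike φ) : ‖m‖ₑ ≤ infEDist 0 (frontier (f '' disk)) := by
  rw [le_infEDist]
  intro y hy
  rw [edist_comm, edist_zero_right, ← ofReal_norm, ← ofReal_norm]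
  refine ENNReal.ofReal_le_ofReal (le_of_forall_lt_imp_le_of_dense fun c hc => ?_)
  obtain ⟨r, hr, h_lt⟩ :=
    mem_nhdsLT_iff_exists_Ioo_subset.mp (hm.norm.eventually_const_lt hc)
  refine le_norm_of_mem_frontier_image hf.1 hr (fun z hz hzr => ?_) hy
  exact (h_lt ⟨hzr, mem_disk.mp hz⟩).le.trans (norm_koebe_neg_le_norm hφ hφ_min hh hf hz)

theorem isBohrRadius_of_koebe_add_eq_zero (hφ : DifferentiableOn ℂ φ disk)
    (hc : ∀ n, 0 ≤ taylorCoeff φ n)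
    (hφ_min : ∀ z ∈ disk, ∀ r < (1 : ℝ), ‖z‖ ≤ r → (φ (-r)).re ≤ (φ z).re)
    (hh : IsKoebeFunction φ h) (hm : Tendsto (fun r : ℝ => h (-(r : ℂ))) (𝓝[<] 1) (𝓝 m))
    (hr : r ∈ Ioc (0 : ℝ) (1 / 3)) (hroot : h r + m = 0) :
    IsBohrRadius (maMindaStarlike φ) r := by
  have h_mono := strictMonoOn_norm_koebe hφ hc hh
  have hm_norm : ‖m‖ = ‖h r‖ := by rw [eq_neg_of_add_eq_zero_left hroot, norm_neg]
  have hr1 : r < 1 := by linarith [hr.2]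
  refine ⟨⟨⟨hr.1, hr1⟩, fun f hf z hz => ?_⟩, fun ρ ⟨hρ, h_bohr⟩ => ?_⟩
  · rw [bohrInequality_iff hf.1]
    calc majorant f ‖z‖ₑ ≤ majorant f (ENNReal.ofReal r) := majorant_mono f <| by
          rw [← ofReal_norm]
          exact ENNReal.ofReal_le_ofReal hz
      _ ≤ ‖h r‖ₑ := majorant_le_enorm_koebe hφ hc hh hf hr.1.le hr.2
      _ = ‖m‖ₑ := by rw [← ofReal_norm, ← ofReal_norm, hm_norm]
      _ ≤ infEDist 0 (frontier (f '' disk)) := enorm_le_infEDist_frontier hφ hφ_min hh hm hf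
  · have hρ_norm : ‖(ρ : ℂ)‖ = ρ := Complex.norm_of_nonneg hρ.1.le
    have h_le : ‖h ρ‖ₑ ≤ ‖m‖ₑ :=
      calc ‖h ρ‖ₑ ≤ majorant h ‖(ρ : ℂ)‖ₑ :=
            enorm_le_majorant hh.1.1 (mem_disk.mpr (hρ_norm.trans_lt hρ.2))
        _ ≤ infEDist 0 (frontier (h '' disk)) :=
            (bohrInequality_iff hh.1 ρ).mp (h_bohr h hh.mem_maMindaStarlike ρ hρ_norm.le)
        _ ≤ ‖m‖ₑ := by
            rw [← edist_zero_right, edist_comm]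
            exact infEDist_le_edist_of_mem (mem_frontier_image_of_tendsto_neg hh.1 hm)
    rw [enorm_le_iff_norm_le, hm_norm] at h_le
    exact (h_mono.le_iff_le ⟨hρ.1.le, hρ.2⟩ ⟨hr.1.le, hr1⟩).mp h_le

end BohrRadius

section Existence

variable {F F' H H' φ : ℂ → ℂ}

-- The Noshiro–Warschawski criterion.
lemma injOn_of_re_deriv_pos {s : Set ℂ} (hs : Convex ℝ s) (hF : ∀ z ∈ s, HasDerivAt F (F' z) z)
    (hpos : ∀ z ∈ s, 0 < (F' z).re) : InjOn F s := by
  intro a ha b hb hab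
  by_contra h_ne
  set c : ℂ := b - a with hc
  have hmem (t : ℝ) (ht : t ∈ Icc (0 : ℝ) 1) : a + t * c ∈ s := by
    simpa only [Complex.real_smul] using hs.add_smul_sub_mem ha hb ht
  have h_deriv (t : ℝ) (ht : t ∈ Icc (0 : ℝ) 1) :
      HasDerivAt (fun t : ℝ => (F (a + t * c) * (starRingEnd ℂ) c).re)
        (F' (a + t * c) * (starRingEnd ℂ) c * c).re t :=
    hasDerivAt_re_comp_line ((hF _ (hmem t ht)).mul_const _)
  have h_mono : StrictMonoOn (fun t : ℝ => (F (a + t * c) * (starRingEnd ℂ) c).re) (Icc 0 1) := by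
    refine strictMonoOn_of_hasDerivWithinAt_pos (convex_Icc _ _)
      (fun t ht => (h_deriv t ht).continuousAt.continuousWithinAt)
      (fun t ht => (h_deriv t (interior_subset ht)).hasDerivWithinAt) fun t ht => ?_
    rw [mul_assoc, mul_comm (starRingEnd ℂ c), Complex.mul_conj, mul_comm, Complex.re_ofReal_mul]
    exact mul_pos (Complex.normSq_pos.mpr (sub_ne_zero.mpr (Ne.symm h_ne)))
      (hpos _ (hmem t (interior_subset ht)))
  have h_lt := h_mono (left_mem_Icc.mpr zero_le_one) (right_mem_Icc.mpr zero_le_one) zero_lt_one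
  simp [hc, hab] at h_lt

lemma exp_mem_disk {ζ : ℂ} (hζ : ζ.re < 0) : Complex.exp ζ ∈ disk := by
  rwa [mem_disk, Complex.norm_exp, Real.exp_lt_one_iff]

lemma log_re_neg {z : ℂ} (hz : z ∈ disk) (hz0 : z ≠ 0) : (Complex.log z).re < 0 := by
  rw [Complex.log_re]
  exact Real.log_neg (norm_pos_iff.mpr hz0) (mem_disk.mp hz)

lemma injOn_add_comp_exp (hH : ∀ z ∈ disk, HasDerivAt H (H' z) z)
    (hpos : ∀ z ∈ disk, 0 < (1 + z * H' z).re) :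
    InjOn (fun ζ => ζ + H (Complex.exp ζ)) {ζ | ζ.re < 0} := by
  refine injOn_of_re_deriv_pos (F' := fun ζ => 1 + Complex.exp ζ * H' (Complex.exp ζ))
    (convex_halfSpace_re_lt 0) (fun ζ hζ => ?_) fun ζ hζ => hpos _ (exp_mem_disk hζ)
  rw [mul_comm]
  exact (hasDerivAt_id' ζ).add ((hH _ (exp_mem_disk hζ)).comp ζ (Complex.hasDerivAt_exp ζ))

lemma injOn_mul_exp (hH : ∀ z ∈ disk, HasDerivAt H (H' z) z)
    (hpos : ∀ z ∈ disk, 0 < (1 + z * H' z).re) :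
    InjOn (fun z => z * Complex.exp (H z)) disk := by
  intro a ha b hb (hab : a * Complex.exp (H a) = b * Complex.exp (H b))
  rcases eq_or_ne a 0 with rfl | ha0
  · rw [zero_mul] at hab
    exact ((mul_eq_zero.mp hab.symm).resolve_right (Complex.exp_ne_zero _)).symm
  have hb0 : b ≠ 0 := by
    rintro rfl
    rw [zero_mul] at hab
    exact ha0 ((mul_eq_zero.mp hab).resolve_right (Complex.exp_ne_zero _))
  -- `log` only gives `log a + H a = log b + H b + 2πin`; the half-plane absorbs the period.
  obtain ⟨n, hn⟩ : ∃ n : ℤ, Complex.log a + H a =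
      Complex.log b + H b + n * (2 * Real.pi * Complex.I) := by
    rw [← Complex.exp_eq_exp_iff_exists_int, Complex.exp_add, Complex.exp_add,
      Complex.exp_log ha0, Complex.exp_log hb0, hab]
  set ζ : ℂ := Complex.log b + n * (2 * Real.pi * Complex.I) with hζ
  have h_exp : Complex.exp ζ = b := by
    rw [hζ, Complex.exp_add, Complex.exp_log hb0, Complex.exp_int_mul_two_pi_mul_I, mul_one]
  have h_re : ζ.re < 0 := by
    simpa [hζ] using log_re_neg hb hb0
  have h_log : Complex.log a = ζ := injOn_add_comp_exp hH hpos (log_re_neg ha ha0) h_re <| by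
    simp only [h_exp, Complex.exp_log ha0]
    rw [hn, hζ]
    ring
  rw [← Complex.exp_log ha0, h_log, h_exp]

theorem exists_isKoebeFunction (hφ : DifferentiableOn ℂ φ disk) (hφ0 : φ 0 = 1)
    (hpos : ∀ z ∈ disk, 0 < (φ z).re) : ∃ h, IsKoebeFunction φ h := by
  obtain ⟨H, hH0, hH⟩ := (differentiableOn_dslope_disk hφ).isExactOn_ball.with_val_at 0 0
  have hφ_eq (z : ℂ) : φ z = 1 + z * dslope φ 0 z := by rw [mul_dslope_zero, hφ0]; ring
  have h_deriv (z : ℂ) (hz : z ∈ disk) :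
      HasDerivAt (fun z => z * Complex.exp (H z)) (φ z * Complex.exp (H z)) z := by
    refine ((hasDerivAt_id' z).mul (hH z hz).cexp).congr_deriv ?_
    rw [hφ_eq]
    ring
  refine ⟨fun z => z * Complex.exp (H z), ⟨differentiableOn_of_hasDerivAt h_deriv,
    injOn_mul_exp hH fun z hz => hφ_eq z ▸ hpos z hz, zero_mul _, ?_⟩, fun z hz => ?_⟩
  · rw [(h_deriv 0 zero_mem_disk).deriv, hφ0, hH0, Complex.exp_zero, mul_one]
  · rcases eq_or_ne z 0 with rfl | hz0
    · rw [starQuotient, if_pos rfl, hφ0]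
    · rw [starQuotient, if_neg hz0, (h_deriv z hz).deriv, mul_left_comm,
        mul_div_cancel_right₀ _ (mul_ne_zero hz0 (Complex.exp_ne_zero _))]

end Existence

section ExponentialOnDisk

open Real

-- The derivative in `t` of `Re exp (ρ e^{it})` is `-ρ exp (ρ cos t) sin (t + ρ sin t)`.
lemma antitoneOn_exp_mul_cos {ρ : ℝ} (hρ0 : 0 ≤ ρ) (hρ1 : ρ ≤ 1) :
    AntitoneOn (fun t => exp (ρ * cos t) * cos (ρ * sin t)) (Icc 0 π) := by
  have h_deriv (t : ℝ) : HasDerivAt (fun t => exp (ρ * cos t) * cos (ρ * sin t))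
      (-(ρ * exp (ρ * cos t) * sin (t + ρ * sin t))) t := by
    refine (((hasDerivAt_cos t).const_mul ρ).exp.mul
      ((hasDerivAt_sin t).const_mul ρ).cos).congr_deriv ?_
    rw [sin_add]
    ring
  refine antitoneOn_of_hasDerivWithinAt_nonpos (convex_Icc _ _)
    (fun t _ => (h_deriv t).continuousAt.continuousWithinAt)
    (fun t _ => (h_deriv t).hasDerivWithinAt) fun t ht => ?_
  rw [interior_Icc] at ht
  have h_sin : 0 ≤ sin t := sin_nonneg_of_nonneg_of_le_pi ht.1.le ht.2.le
  have h_sin_le : sin t ≤ π - t := by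
    rw [← sin_pi_sub]
    exact sin_le (by linarith [ht.2])
  have h_angle : 0 ≤ sin (t + ρ * sin t) :=
    sin_nonneg_of_nonneg_of_le_pi (add_nonneg ht.1.le (mul_nonneg hρ0 h_sin))
      (by linarith [mul_le_of_le_one_left h_sin hρ1])
  exact neg_nonpos.mpr (by positivity)

lemma exp_neg_norm_le_re_exp {w : ℂ} (hw : ‖w‖ ≤ 1) : exp (-‖w‖) ≤ (Complex.exp w).re := by
  have h_cos : ‖w‖ * cos |w.arg| = w.re := by rw [cos_abs, Complex.norm_mul_cos_arg]
  have h_sin : cos (‖w‖ * sin |w.arg|) = cos w.im := by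
    rw [← Complex.norm_mul_sin_arg w]
    rcases abs_choice w.arg with h | h
    · rw [h]
    · rw [h, sin_neg, mul_neg, cos_neg]
  have h_arg : |w.arg| ∈ Icc 0 π := ⟨abs_nonneg _, Complex.abs_arg_le_pi w⟩
  have h_le := antitoneOn_exp_mul_cos (norm_nonneg w) hw h_arg (right_mem_Icc.mpr pi_pos.le) h_arg.2
  simp only [h_cos, h_sin, cos_pi, sin_pi, mul_zero, cos_zero, mul_one, mul_neg] at h_le
  rwa [Complex.exp_re]

end ExponentialOnDisk

section ExpFun

variable {α : ℝ}

lemma expFun_zero : expFun 0 = Complex.exp := by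
  ext z
  simp [expFun]

lemma expFun_apply_zero (α : ℝ) : expFun α 0 = 1 := by simp [expFun]

lemma hasDerivAt_expFun (α : ℝ) (z : ℂ) :
    HasDerivAt (expFun α) ((1 - α) * Complex.exp z) z :=
  ((Complex.hasDerivAt_exp z).const_mul _).const_add _

lemma differentiableOn_expFun (α : ℝ) : DifferentiableOn ℂ (expFun α) disk :=
  differentiableOn_of_hasDerivAt fun z _ => hasDerivAt_expFun α z

lemma taylorCoeff_expFun_nonneg (hα : α ≤ 1) : ∀ n, 0 ≤ taylorCoeff (expFun α) n :=
  taylorCoeff_nonneg_of_deriv (by rw [expFun_apply_zero]; exact zero_le_one) fun n => by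
    have h_factor : (0 : ℂ) ≤ 1 - α := by exact_mod_cast sub_nonneg.mpr hα
    rw [funext fun z => (hasDerivAt_expFun α z).deriv, taylorCoeff, iteratedDeriv_const_mul_field,
      mul_div_assoc]
    exact mul_nonneg h_factor (taylorCoeff_exp_nonneg n)

lemma re_expFun (α : ℝ) (z : ℂ) : (expFun α z).re = α + (1 - α) * (Complex.exp z).re := by
  rw [expFun, ← Complex.ofReal_one, ← Complex.ofReal_sub, Complex.add_re, Complex.re_ofReal_mul,
    Complex.ofReal_re]

lemma re_expFun_neg_le (hα : α ≤ 1) {z : ℂ} (hz : z ∈ disk) {r : ℝ} (hzr : ‖z‖ ≤ r) :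
    (expFun α (-r)).re ≤ (expFun α z).re := by
  have h_exp : (Complex.exp (-r : ℂ)).re = Real.exp (-r) := by
    rw [← Complex.ofReal_neg, Complex.exp_ofReal_re]
  rw [re_expFun, re_expFun, h_exp]
  gcongr
  exact (Real.exp_le_exp.mpr (neg_le_neg hzr)).trans (exp_neg_norm_le_re_exp (mem_disk.mp hz).le)

lemma re_expFun_pos (hα : α < 1) (h : 0 ≤ α + (1 - α) * Real.exp (-1)) {z : ℂ} (hz : z ∈ disk) :
    0 < (expFun α z).re := by
  have h_exp : Real.exp (-1) < (Complex.exp z).re :=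
    (Real.exp_lt_exp.mpr (neg_lt_neg (mem_disk.mp hz))).trans_le
      (exp_neg_norm_le_re_exp (mem_disk.mp hz).le)
  rw [re_expFun]
  exact h.trans_lt (by gcongr)

end ExpFun

section KoebeReal

variable {α : ℝ} {h : ℂ → ℂ}

/-- The primitive `∫₀ˣ (eᵗ - 1) / t dt`, which is the logarithm of the Koebe-type function of
`e ^ z` divided by `x`; `dslope` fills in the removable singularity of the integrand. -/
def expIntegral (x : ℝ) : ℝ := ∫ t in 0..x, dslope Real.exp 0 t

/-- The restriction to the real axis of the Koebe-type function of `expFun α`, which extends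
continuously past the endpoints of `(-1, 1)`. -/
def koebeReal (α x : ℝ) : ℝ := x * Real.exp ((1 - α) * expIntegral x)

lemma continuous_dslope_exp : Continuous (dslope Real.exp 0) := by
  rw [← continuousOn_univ, continuousOn_dslope univ_mem]
  exact ⟨Real.continuous_exp.continuousOn, Real.differentiableAt_exp⟩

lemma continuous_koebeReal (α : ℝ) : Continuous (koebeReal α) :=
  continuous_id.mul <| Real.continuous_exp.comp <| continuous_const.mul <|
    intervalIntegral.continuous_primitive
      (fun _ _ => continuous_dslope_exp.intervalIntegrable _ _) 0

lemma dslope_expFun_ofReal (α x : ℝ) :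
    dslope (expFun α) 0 x = ((1 - α) * dslope Real.exp 0 x : ℝ) := by
  rcases eq_or_ne x 0 with rfl | hx
  · rw [Complex.ofReal_zero, dslope_same, dslope_same, (hasDerivAt_expFun α 0).deriv,
      Real.deriv_exp, Complex.exp_zero, Real.exp_zero]
    push_cast
    rfl
  · rw [dslope_of_ne _ (Complex.ofReal_ne_zero.mpr hx), dslope_of_ne _ hx, slope_def_field,
      slope_def_field, expFun_apply_zero, expFun, Real.exp_zero]
    push_cast
    ring

lemma IsKoebeFunction.apply_ofReal (hh : IsKoebeFunction (expFun α) h) {x : ℝ} (hx : |x| < 1) :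
    h x = koebeReal α x := by
  obtain ⟨H, hH0, hH, hhH⟩ := exists_dslope_eq_exp hh.1 (differentiableOn_expFun α) hh.2
  have h_mem {t : ℝ} (ht : t ∈ uIcc 0 x) : (t : ℂ) ∈ disk := by
    rw [mem_disk, Complex.norm_real, Real.norm_eq_abs]
    simpa using (abs_sub_left_of_mem_uIcc ht).trans_lt (by simpa using hx)
  have h_log : H x = ((1 - α) * expIntegral x : ℝ) := by
    rw [expIntegral, ← intervalIntegral.integral_const_mul, ← intervalIntegral.integral_ofReal,
      ← sub_zero (H x), ← hH0, ← Complex.ofReal_zero]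
    refine (intervalIntegral.integral_eq_sub_of_hasDerivAt (f := fun t : ℝ => H t)
      (fun t ht => ?_) ?_).symm
    · rw [← dslope_expFun_ofReal]
      exact (hH t (h_mem ht)).comp_ofReal
    · exact (Complex.continuous_ofReal.comp
        (continuous_const.mul continuous_dslope_exp)).intervalIntegrable _ _
  have h_eq := mul_dslope_zero h x
  rw [hh.1.2.2.1, sub_zero, hhH x (h_mem right_mem_uIcc), h_log] at h_eq
  rw [← h_eq, koebeReal]
  push_cast
  rfl

lemma IsKoebeFunction.tendsto_neg (hh : IsKoebeFunction (expFun α) h) :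
    Tendsto (fun r : ℝ => h (-(r : ℂ))) (𝓝[<] 1) (𝓝 (koebeReal α (-1) : ℂ)) := by
  have h_cont : Continuous fun r : ℝ => (koebeReal α (-r) : ℂ) :=
    Complex.continuous_ofReal.comp ((continuous_koebeReal α).comp continuous_neg)
  refine ((h_cont.tendsto 1).mono_left nhdsWithin_le_nhds).congr' ?_
  filter_upwards [Ioo_mem_nhdsLT (zero_lt_one' ℝ)] with r hr
  rw [← Complex.ofReal_neg, hh.apply_ofReal]
  rw [abs_neg, abs_of_pos hr.1]
  exact hr.2

lemma abs_dslope_exp_sub_sum_le {x : ℝ} (hx : |x| ≤ 1) (n : ℕ) :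
    |dslope Real.exp 0 x - ∑ k ∈ Finset.range n, x ^ k / (k + 1).factorial| ≤
      |x| ^ n * ((n + 2) / ((n + 1).factorial * (n + 1))) := by
  rcases eq_or_ne x 0 with rfl | hx0
  · cases n with
    | zero => norm_num
    | succ n => simp [Finset.sum_range_succ']
  have h_exp : dslope Real.exp 0 x * x = Real.exp x - 1 := by
    simpa [mul_comm] using sub_smul_dslope Real.exp 0 x
  have h_bound := Real.exp_bound hx n.succ_pos
  rw [Finset.sum_range_succ', pow_zero, Nat.factorial_zero, Nat.cast_one, div_one] at h_bound
  have h_sum : (∑ k ∈ Finset.range n, x ^ k / (k + 1).factorial) * x =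
      ∑ k ∈ Finset.range n, x ^ (k + 1) / (k + 1).factorial := by
    rw [Finset.sum_mul]
    exact Finset.sum_congr rfl fun k _ => by ring
  refine le_of_mul_le_mul_right ?_ (abs_pos.mpr hx0)
  rw [← abs_mul, sub_mul, h_exp, h_sum]
  calc |Real.exp x - 1 - ∑ k ∈ Finset.range n, x ^ (k + 1) / (k + 1).factorial|
      = |Real.exp x - (∑ k ∈ Finset.range n, x ^ (k + 1) / (k + 1).factorial + 1)| := by
        rw [sub_sub, add_comm]
    _ ≤ |x| ^ (n + 1) * ((n + 1).succ / ((n + 1).factorial * (n + 1 : ℕ))) := h_bound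
    _ = |x| ^ n * ((n + 2) / ((n + 1).factorial * (n + 1))) * |x| := by
        push_cast
        ring

lemma lt_expIntegral_sub : 1.159903 < expIntegral (1 / 3) - expIntegral (-1) := by
  have h_le (x : ℝ) (hx : x ∈ Icc (-1 : ℝ) (1 / 3)) :
      ∑ k ∈ Finset.range 8, x ^ k / (k + 1).factorial - x ^ 8 * (10 / (Nat.factorial 9 * 9)) ≤
        dslope Real.exp 0 x := by
    have h_abs := abs_dslope_exp_sub_sum_le (abs_le.mpr ⟨hx.1, by linarith [hx.2]⟩) 8
    rw [Even.pow_abs (by decide)] at h_abs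
    have := (abs_le.mp h_abs).1
    norm_num at this ⊢
    linarith
  have h_int := intervalIntegral.integral_mono_on (μ := MeasureTheory.volume) (by norm_num)
    (Continuous.intervalIntegrable (by fun_prop) _ _)
    (continuous_dslope_exp.intervalIntegrable _ _) h_le
  rw [expIntegral, expIntegral, intervalIntegral.integral_interval_sub_left
    (continuous_dslope_exp.intervalIntegrable _ _) (continuous_dslope_exp.intervalIntegrable _ _)]
  refine lt_of_lt_of_le ?_ h_int
  rw [intervalIntegral.integral_sub (Continuous.intervalIntegrable (by fun_prop) _ _)
      (Continuous.intervalIntegrable (by fun_prop) _ _),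
    intervalIntegral.integral_finsetSum fun _ _ =>
      Continuous.intervalIntegrable (by fun_prop) _ _, intervalIntegral.integral_mul_const]
  simp only [intervalIntegral.integral_div, integral_pow]
  norm_num [Finset.sum_range_succ, Nat.factorial]

lemma three_lt_exp_mul (hα : α < 0.05284) :
    3 < Real.exp ((1 - α) * (expIntegral (1 / 3) - expIntegral (-1))) := by
  have h_arg : 1.098613 ≤ (1 - α) * (expIntegral (1 / 3) - expIntegral (-1)) := by
    have h_lt := lt_expIntegral_sub
    norm_num at hα h_lt ⊢
    nlinarith
  calc (3 : ℝ) < ∑ k ∈ Finset.range 14, (1.098613 : ℝ) ^ k / k.factorial := by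
        norm_num [Finset.sum_range_succ, Nat.factorial]
    _ ≤ Real.exp 1.098613 := Real.sum_le_exp_of_nonneg (by norm_num) 14
    _ ≤ _ := Real.exp_le_exp.mpr h_arg

lemma exists_koebeReal_add_eq_zero (hα : α < 0.05284) :
    ∃ r ∈ Ioo (0 : ℝ) (1 / 3), koebeReal α r + koebeReal α (-1) = 0 := by
  have h_zero : koebeReal α 0 + koebeReal α (-1) < 0 := by
    simp [koebeReal, Real.exp_pos]
  have h_third : 0 < koebeReal α (1 / 3) + koebeReal α (-1) := by
    have h_exp := three_lt_exp_mul hα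
    rw [mul_sub, Real.exp_sub, lt_div_iff₀ (Real.exp_pos _)] at h_exp
    rw [koebeReal, koebeReal]
    linarith
  exact intermediate_value_Ioo (by norm_num)
    ((continuous_koebeReal α).add continuous_const).continuousOn ⟨h_zero, h_third⟩

end KoebeReal

end BohrStarlike

end

theorem corollary2p4_general (α : ℝ) (hα : α < 0.05284) :
    (0 ≤ α + (1 - α) * Real.exp (-1) →
      ∃ h : ℂ → ℂ, BohrStarlike.IsKoebeFunction (BohrStarlike.expFun α) h) ∧
    ∀ h : ℂ → ℂ, BohrStarlike.IsKoebeFunction (BohrStarlike.expFun α) h →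
      ∃ (m : ℂ) (rf : ℝ),
        Tendsto (fun r : ℝ => h (-(r : ℂ))) (𝓝[<] 1) (𝓝 m) ∧
        IsLeast {r : ℝ | r ∈ Ioo (0 : ℝ) 1 ∧ h (r : ℂ) + m = 0} rf ∧
        rf < 1 / 3 ∧
        BohrStarlike.IsBohrRadius
          (BohrStarlike.maMindaStarlike (BohrStarlike.expFun α)) rf ∧
        (α = 0 → BohrStarlike.IsBohrRadius
          (BohrStarlike.maMindaStarlike Complex.exp) rf) := by
  have hα1 : α < 1 := hα.trans (by norm_num)
  have hφ := BohrStarlike.differentiableOn_expFun α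
  have hc := BohrStarlike.taylorCoeff_expFun_nonneg hα1.le
  refine ⟨fun h_pos => BohrStarlike.exists_isKoebeFunction hφ (BohrStarlike.expFun_apply_zero α)
    fun z hz => BohrStarlike.re_expFun_pos hα1 h_pos hz, fun h hh => ?_⟩
  obtain ⟨r, hr, h_root_real⟩ := BohrStarlike.exists_koebeReal_add_eq_zero hα
  have hr1 : r ∈ Ioo (0 : ℝ) 1 := ⟨hr.1, hr.2.trans (by norm_num)⟩
  have h_root : h r + BohrStarlike.koebeReal α (-1) = 0 := by
    rw [hh.apply_ofReal (by rw [abs_of_pos hr.1]; exact hr1.2)]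
    exact_mod_cast h_root_real
  have h_bohr := BohrStarlike.isBohrRadius_of_koebe_add_eq_zero hφ hc
    (fun z hz s _ => BohrStarlike.re_expFun_neg_le hα1.le hz) hh hh.tendsto_neg
    ⟨hr.1, hr.2.le⟩ h_root
  refine ⟨_, r, hh.tendsto_neg, ⟨⟨hr1, h_root⟩, fun s ⟨hs, hs_root⟩ => ?_⟩, hr.2, h_bohr, ?_⟩
  · have h_norm : ‖h r‖ = ‖h s‖ := congrArg norm (add_right_cancel (h_root.trans hs_root.symm))
    exact ((BohrStarlike.strictMonoOn_norm_koebe hφ hc hh).injOn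
      ⟨hr1.1.le, hr1.2⟩ ⟨hs.1.le, hs.2⟩ h_norm).le
  · rintro rfl
    rwa [BohrStarlike.expFun_zero] at h_bohr

/-- `m` is the value `h(-1)`, understood as the limit of `h(-r)` as `r → 1⁻`. -/
theorem corollary2p4 (α : ℝ) (hα₀ : 0 ≤ α) (hα₁ : α < 0.05284) :
    (∃ h : ℂ → ℂ, BohrStarlike.IsKoebeFunction (BohrStarlike.expFun α) h) ∧
    ∀ h : ℂ → ℂ, BohrStarlike.IsKoebeFunction (BohrStarlike.expFun α) h →
      ∃ (m : ℂ) (rf : ℝ),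
        Tendsto (fun r : ℝ => h (-(r : ℂ))) (𝓝[<] 1) (𝓝 m) ∧
        IsLeast {r : ℝ | r ∈ Ioo (0 : ℝ) 1 ∧ h (r : ℂ) + m = 0} rf ∧
        rf < 1 / 3 ∧
        BohrStarlike.IsBohrRadius
          (BohrStarlike.maMindaStarlike (BohrStarlike.expFun α)) rf ∧
        (α = 0 → BohrStarlike.IsBohrRadius
          (BohrStarlike.maMindaStarlike Complex.exp) rf) :=
  (corollary2p4_general α hα₁).imp_left fun h_exists =>
    h_exists (add_nonneg hα₀ (mul_nonneg (by linarith) (Real.exp_pos _).le))
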